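/- Let $d\ge 1$ and let $f:\mathbb{R}^d\to\mathbb{R}$ be continuously differentiable. For $a\in\mathbb{R}$ let $\operatorname{sign}(a)\in\{-1,0,1\}$ be the usual sign (with $\operatorname{sign}(0)=0$), and let $\operatorname{Sign}(a)=\{1\}$ if $a>0$, $[-1,1]$ if $a=0$, $\{-1\}$ if $a<0$; for $u\in\mathbb{R}^d$ let $\operatorname{Sign}(u)=\{v\in\mathbb{R}^d: v_i\in\operatorname{Sign}(u_i)\text{ for all }i\}$. Write $e^{(i)}$ for the standard basis vectors. Define $F_\infty(x):=-\operatorname{Sign}(\nabla f(x))$. Define the set of greedy coordinate directions $$D(x):=\Big\{-\operatorname{sign}(\partial_i f(x))\,e^{(i)}:\ i\in\arg\max_{j}|\partial_j f(x)|\Big\},$$ and let $F_{\ell_1}$ be the Filippov regularization of a greedy coordinate selector, that is, of an arbitrary function $G:\mathbb{R}^d\to\mathbb{R}^d$ with $G(x)\in D(x)$ for all $x$: $$F_{\ell_1}(x):=\bigcap_{\delta>0}\overline{\operatorname{conv}}\{G(y):\ \|y-x\|<\delta\};$$ alternatively, let $F_{\ell_1}$ be the regularization of the full multifunction $D$, $$F_{\ell_1}(x):=\bigcap_{\delta>0}\overline{\operatorname{conv}}\bigcup_{\|y-x\|<\delta}D(y).$$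 Let $F$ be $F_\infty$ or $F_{\ell_1}$ (for any choice of $G$, or for $D$). Then: 1. for every $x$ the set $F(x)$ is nonempty, convex and compact; 2. $F$ is outer semicontinuous: if $x_n\to x$, $v_n\to v$ and $v_n\in F(x_n)$ for all $n$, then $v\in F(x)$; 3. $F$ is globally bounded: there is $M$ with $\|v\|\le M$ for all $x$ and all $v\in F(x)$; 4. $F$ is a Marchaud map, that is, $F$ is upper semicontinuous (for every $x$ and every neighbourhood $U$ of the set $F(x)$, $U$ is a neighbourhood of $F(y)$ for all $y$ close enough to $x$), has nonempty convex compact values, and has linear growth: there is $c$ with $\|v\|\le c(1+\|x\|)$ for all $x$ and $v\in F(x)$; 5. for every $x_0\in\mathbb{R}^d$ the differential inclusion $\dot x(t)\in F(x(t))$ has a solution on $[0,\infty)$ starting at $x_0$: a curve $x(\cdot)$ with $x(0)=x_0$ that is absolutely continuous on every interval $[0,T]$, $T>0$, and for almost every $t>0$ is differentiable at $t$ with $\dot x(t)\in F(x(t))$. -/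

import Mathlib

noncomputable section

namespace SignFlow

open Set Filter Topology MeasureTheory
open scoped Pointwise

/-- The set-valued sign of a real number: `{1}`, `[-1, 1]`, `{-1}` for `a > 0`, `a = 0`, `a < 0`. -/
def realSignSet (a : ℝ) : Set ℝ :=
  if 0 < a then {1} else if a < 0 then {-1} else Icc (-1) 1

/-- The set-valued sign of a vector, defined componentwise. -/
def vecSignSet {d : ℕ} (u : EuclideanSpace ℝ (Fin d)) : Set (EuclideanSpace ℝ (Fin d)) :=
  {v | ∀ i, v i ∈ realSignSet (u i)}

/-- The set-valued field `x ↦ -Sign (∇ f x)`. -/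
def signField {d : ℕ} (f : EuclideanSpace ℝ (Fin d) → ℝ) (x : EuclideanSpace ℝ (Fin d)) :
    Set (EuclideanSpace ℝ (Fin d)) :=
  -vecSignSet (gradient f x)

/-- The greedy coordinate directions at `x`: all `-sign (∂ᵢ f x) eᵢ` with `i ∈ argmaxⱼ |∂ⱼ f x|`. -/
def greedyDirections {d : ℕ} (f : EuclideanSpace ℝ (Fin d) → ℝ) (x : EuclideanSpace ℝ (Fin d)) :
    Set (EuclideanSpace ℝ (Fin d)) :=
  {v | ∃ i : Fin d, (∀ j : Fin d, |gradient f x j| ≤ |gradient f x i|) ∧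
    v = -(Real.sign (gradient f x i) • EuclideanSpace.single i (1 : ℝ))}

/-- A (single-valued, possibly discontinuous) greedy coordinate selector of `f`. -/
def IsGreedySelector {d : ℕ} (f : EuclideanSpace ℝ (Fin d) → ℝ)
    (G : EuclideanSpace ℝ (Fin d) → EuclideanSpace ℝ (Fin d)) : Prop :=
  ∀ x, G x ∈ greedyDirections f x

/-- The Filippov regularization of a vector field:
`⋂_{δ > 0} closure (conv {G y : ‖y - x‖ < δ})`. -/
def filippov {d : ℕ} (G : EuclideanSpace ℝ (Fin d) → EuclideanSpace ℝ (Fin d))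
    (x : EuclideanSpace ℝ (Fin d)) : Set (EuclideanSpace ℝ (Fin d)) :=
  ⋂ (δ : ℝ) (_ : 0 < δ), closure (convexHull ℝ {v | ∃ y, ‖y - x‖ < δ ∧ v = G y})

/-- The Filippov regularization of a set-valued field:
`⋂_{δ > 0} closure (conv (⋃_{‖y - x‖ < δ} G y))`. -/
def filippovMulti {d : ℕ} (G : EuclideanSpace ℝ (Fin d) → Set (EuclideanSpace ℝ (Fin d)))
    (x : EuclideanSpace ℝ (Fin d)) : Set (EuclideanSpace ℝ (Fin d)) :=
  ⋂ (δ : ℝ) (_ : 0 < δ), closure (convexHull ℝ {v | ∃ y, ‖y - x‖ < δ ∧ v ∈ G y})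

/-- Outer semicontinuity: every limit of values `vₙ ∈ F (xₙ)` along `xₙ → x` lies in `F x`. -/
def OuterSemicontinuous {d : ℕ}
    (F : EuclideanSpace ℝ (Fin d) → Set (EuclideanSpace ℝ (Fin d))) : Prop :=
  ∀ (x v : EuclideanSpace ℝ (Fin d)) (xs vs : ℕ → EuclideanSpace ℝ (Fin d)),
    Tendsto xs atTop (𝓝 x) → Tendsto vs atTop (𝓝 v) → (∀ n, vs n ∈ F (xs n)) → v ∈ F x

/-- All values lie in one common ball. -/
def GloballyBounded {d : ℕ}
    (F : EuclideanSpace ℝ (Fin d) → Set (EuclideanSpace ℝ (Fin d))) : Prop :=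
  ∃ M : ℝ, ∀ x, ∀ v ∈ F x, ‖v‖ ≤ M

/-- Marchaud maps on the whole space: upper semicontinuous set-valued maps (every neighbourhood of
`F x` contains `F y` for `y` near `x`) with nonempty convex compact values and linear growth. -/
structure IsMarchaud {d : ℕ}
    (F : EuclideanSpace ℝ (Fin d) → Set (EuclideanSpace ℝ (Fin d))) : Prop where
  nonempty : ∀ x, (F x).Nonempty
  convex : ∀ x, Convex ℝ (F x)
  isCompact : ∀ x, IsCompact (F x)
  upperSemicontinuous : UpperHemicontinuous F
  linearGrowth : ∃ c : ℝ, ∀ x, ∀ v ∈ F x, ‖v‖ ≤ c * (1 + ‖x‖)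

/-- `γ` is, on `[0, ∞)`, a (locally) absolutely continuous solution of `γ' ∈ F (γ)` that starts at
`x₀`. The values `γ t` for `t < 0` are irrelevant. -/
structure IsSolutionFrom {d : ℕ}
    (F : EuclideanSpace ℝ (Fin d) → Set (EuclideanSpace ℝ (Fin d)))
    (x₀ : EuclideanSpace ℝ (Fin d)) (γ : ℝ → EuclideanSpace ℝ (Fin d)) : Prop where
  initial : γ 0 = x₀
  absolutelyContinuous : ∀ T : ℝ, 0 < T → AbsolutelyContinuousOnInterval γ 0 T
  inclusion : ∀ᵐ t : ℝ, 0 < t → ∃ v ∈ F (γ t), HasDerivAt γ v t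

end SignFlow

end

namespace SignFlow

open Set Filter Topology MeasureTheory

section Euler

variable {E : Type*} [NormedAddCommGroup E] [NormedSpace ℝ E]

/-- The explicit Euler iterates of the vector field `g` with step size `h`, started at `x₀`. -/
def eulerSeq (g : E → E) (h : ℝ) (x₀ : E) : ℕ → E
  | 0 => x₀
  | k + 1 => eulerSeq g h x₀ k + h • g (eulerSeq g h x₀ k)

theorem eulerSeq_sub_eq_smul_sum (g : E → E) (h : ℝ) (x₀ : E) {i j : ℕ} (hij : i ≤ j) :
    eulerSeq g h x₀ j - eulerSeq g h x₀ i =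
      h • ∑ k ∈ Finset.Ico i j, g (eulerSeq g h x₀ k) := by
  induction j, hij using Nat.le_induction with
  | base => simp
  | succ j hij ih =>
    rw [Finset.sum_Ico_succ_top hij, smul_add, ← ih, eulerSeq]
    abel

theorem norm_eulerSeq_sub_le {g : E → E} {M h : ℝ} (hg : ∀ x, ‖g x‖ ≤ M) (hh : 0 ≤ h) (x₀ : E)
    {i j : ℕ} (hij : i ≤ j) :
    ‖eulerSeq g h x₀ j - eulerSeq g h x₀ i‖ ≤ M * (j * h - i * h) := by
  rw [eulerSeq_sub_eq_smul_sum g h x₀ hij, norm_smul, Real.norm_of_nonneg hh]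
  have h1 : ‖∑ k ∈ Finset.Ico i j, g (eulerSeq g h x₀ k)‖ ≤ ((j : ℝ) - i) * M := by
    refine (norm_sum_le_of_le _ fun k _ => hg (eulerSeq g h x₀ k)).trans ?_
    simp [Nat.cast_sub hij]
  calc h * _ ≤ h * (((j : ℝ) - i) * M) := by gcongr
    _ = _ := by ring

/-- The difference quotients of the Euler iterates are averages of values of the field. -/
theorem eulerSeq_slope_mem {g : E → E} {h : ℝ} (hh : 0 < h) (x₀ : E) {C : Set E}
    (hC : Convex ℝ C) {i j : ℕ} (hij : i < j)
    (hgC : ∀ k, i ≤ k → k < j → g (eulerSeq g h x₀ k) ∈ C) :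
    (j * h - i * h)⁻¹ • (eulerSeq g h x₀ j - eulerSeq g h x₀ i) ∈ C := by
  have hpos : (0 : ℝ) < (j : ℝ) - i := sub_pos.2 (by exact_mod_cast hij)
  have key : ∑ k ∈ Finset.Ico i j, ((j : ℝ) - i)⁻¹ • g (eulerSeq g h x₀ k) ∈ C := by
    refine hC.sum_mem (fun _ _ => by positivity) ?_ fun k hk => ?_
    · rw [Finset.sum_const, Nat.card_Ico, nsmul_eq_mul, Nat.cast_sub hij.le,
        mul_inv_cancel₀ hpos.ne']
    · exact hgC k (Finset.mem_Ico.1 hk).1 (Finset.mem_Ico.1 hk).2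
  rw [← Finset.smul_sum] at key
  rw [eulerSeq_sub_eq_smul_sum g h x₀ hij.le, smul_smul]
  convert key using 2
  rw [← sub_mul, mul_inv, mul_assoc, inv_mul_cancel₀ hh.ne', mul_one]

/-- The Euler step function with step size `1 / (n + 1)`. -/
noncomputable def eulerStep (g : E → E) (x₀ : E) (n : ℕ) (t : ℝ) : E :=
  eulerSeq g ((n : ℝ) + 1)⁻¹ x₀ ⌊t * ((n : ℝ) + 1)⌋₊

theorem tendsto_floor_mul_succ {t : ℝ} (ht : 0 ≤ t) :
    Tendsto (fun n : ℕ => (⌊t * ((n : ℝ) + 1)⌋₊ : ℝ) * ((n : ℝ) + 1)⁻¹) atTop (𝓝 t) :=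
  (tendsto_nat_floor_mul_div_atTop ht).comp
    (tendsto_atTop_add_const_right _ 1 tendsto_natCast_atTop_atTop)

variable [FiniteDimensional ℝ E]

theorem exists_tendsto_eulerStep {g : E → E} {M : ℝ} (hg : ∀ x, ‖g x‖ ≤ M) (x₀ : E) (t : ℝ) :
    ∃ y, Tendsto (fun n => eulerStep g x₀ n t) (hyperfilter ℕ) (𝓝 y) := by
  have hM : 0 ≤ M := (norm_nonneg _).trans (hg x₀)
  have hmem : ∀ n, eulerStep g x₀ n t ∈ Metric.closedBall x₀ (M * max t 0) := fun n => by
    have hn : (0 : ℝ) < (n : ℝ) + 1 := by positivity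
    rw [mem_closedBall_iff_norm]
    refine (norm_eulerSeq_sub_le hg (inv_nonneg.2 hn.le) x₀ (Nat.zero_le _)).trans ?_
    refine mul_le_mul_of_nonneg_left ?_ hM
    rw [Nat.cast_zero, zero_mul, sub_zero, ← div_eq_mul_inv, div_le_iff₀ hn]
    rcases le_total 0 t with ht | ht
    · rw [max_eq_left ht]
      exact Nat.floor_le (by positivity)
    · rw [Nat.floor_of_nonpos (mul_nonpos_of_nonpos_of_nonneg ht hn.le), max_eq_right ht]
      simp
  have : ProperSpace E := FiniteDimensional.proper ℝ E
  obtain ⟨y, -, hy⟩ := (isCompact_closedBall x₀ (M * max t 0)).ultrafilter_le_nhds'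
    ((hyperfilter ℕ).map fun n => eulerStep g x₀ n t) (mem_map.2 (univ_mem' hmem))
  exact ⟨y, hy⟩

/-- A limit of Euler step functions: its difference quotients lie in every closed convex set that
contains the values of the field near the curve. -/
theorem exists_euler_limit {g : E → E} {M : ℝ} (hg : ∀ x, ‖g x‖ ≤ M) (x₀ : E) :
    ∃ γ : ℝ → E, γ 0 = x₀ ∧ ∀ (s t η : ℝ) (C : Set E), 0 ≤ s → s < t → 0 < η → Convex ℝ C →
      IsClosed C → (∀ y, ‖y - γ s‖ ≤ M * (t - s) + η → g y ∈ C) →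
        (t - s)⁻¹ • (γ t - γ s) ∈ C := by
  have hM : 0 ≤ M := (norm_nonneg _).trans (hg x₀)
  choose γ hγ using exists_tendsto_eulerStep hg x₀
  refine ⟨γ, ?_, fun s t η C hs hst hη hC hC' hgC => ?_⟩
  · refine tendsto_nhds_unique (hγ 0) ?_
    simp [eulerStep, eulerSeq]
  have hle : (hyperfilter ℕ : Filter ℕ) ≤ atTop := Nat.hyperfilter_le_atTop
  have hS := (tendsto_floor_mul_succ hs).mono_left hle
  have hT := (tendsto_floor_mul_succ (hs.trans hst.le)).mono_left hle
  have hD := hT.sub hS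
  refine hC'.mem_of_tendsto ((hD.inv₀ (sub_pos.2 hst).ne').smul ((hγ t).sub (hγ s))) ?_
  have hnear : ∀ᶠ n : ℕ in (hyperfilter ℕ : Filter ℕ), M *
      ((⌊t * ((n : ℝ) + 1)⌋₊ : ℝ) * ((n : ℝ) + 1)⁻¹ - (⌊s * ((n : ℝ) + 1)⌋₊ : ℝ) *
        ((n : ℝ) + 1)⁻¹) + ‖eulerStep g x₀ n s - γ s‖ < M * (t - s) + η := by
    refine ((hD.const_mul M).add ((hγ s).sub_const (γ s)).norm).eventually_lt_const ?_
    simpa using hη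
  filter_upwards [hnear, hS.eventually_lt hT hst] with n hn hlt
  have hn0 : (0 : ℝ) < ((n : ℝ) + 1)⁻¹ := by positivity
  refine eulerSeq_slope_mem hn0 x₀ hC
    (by exact_mod_cast lt_of_mul_lt_mul_right hlt hn0.le) fun k hik hkj => hgC _ ?_
  refine le_trans ?_ hn.le
  refine (norm_sub_le_norm_sub_add_norm_sub _ (eulerStep g x₀ n s) _).trans ?_
  gcongr
  refine (norm_eulerSeq_sub_le hg hn0.le x₀ hik).trans ?_
  gcongr

/-- Existence of Lipschitz solutions of differential inclusions with bounded, upper hemicontinuous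
right-hand sides with nonempty closed convex values. -/
theorem exists_lipschitz_solution {F : E → Set E} (hne : ∀ x, (F x).Nonempty)
    (hconv : ∀ x, Convex ℝ (F x)) (hcl : ∀ x, IsClosed (F x)) {M : ℝ}
    (hM : ∀ x, ∀ v ∈ F x, ‖v‖ ≤ M) (hF : UpperHemicontinuous F) (x₀ : E) :
    ∃ γ : ℝ → E, γ 0 = x₀ ∧ LipschitzOnWith M.toNNReal γ (Ici 0) ∧
      ∀ᵐ t : ℝ, 0 < t → ∃ v ∈ F (γ t), HasDerivAt γ v t := by
  choose g hg using hne
  have hgM : ∀ x, ‖g x‖ ≤ M := fun x => hM x _ (hg x)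
  have hM0 : 0 ≤ M := (norm_nonneg _).trans (hgM x₀)
  obtain ⟨γ, h0, hγ⟩ := exists_euler_limit hgM x₀
  have hlt : ∀ s t, 0 ≤ s → s < t → dist (γ t) (γ s) ≤ M * dist t s := fun s t hs hst => by
    have h := hγ s t 1 (Metric.closedBall 0 M) hs hst one_pos (convex_closedBall _ _)
      Metric.isClosed_closedBall fun y _ => by simpa using hgM y
    have hpos := sub_pos.2 hst
    rw [mem_closedBall_zero_iff, norm_smul, norm_inv, Real.norm_of_nonneg hpos.le,
      inv_mul_le_iff₀ hpos, mul_comm] at h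
    rwa [dist_eq_norm, Real.dist_eq, abs_of_pos hpos]
  have hlip : LipschitzOnWith M.toNNReal γ (Ici 0) := by
    refine LipschitzOnWith.of_dist_le_mul fun s hs t ht => ?_
    rw [Real.coe_toNNReal M hM0]
    rcases lt_trichotomy s t with h | rfl | h
    · rw [dist_comm, dist_comm s]
      exact hlt s t hs h
    · simp
    · exact hlt t s ht h
  refine ⟨γ, h0, hlip, ?_⟩
  filter_upwards [hlip.locallyBoundedVariationOn.ae_differentiableWithinAt_of_mem] with t ht hpos
  have hder := ((ht hpos.le).differentiableAt (Ici_mem_nhds hpos)).hasDerivAt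
  refine ⟨_, ?_, hder⟩
  have hmem : ∀ ε > 0, deriv γ t ∈ Metric.cthickening ε (F (γ t)) := fun ε hε => by
    have hev := upperHemicontinuousAt_iff.1 (upperHemicontinuous_iff.1 hF (γ t)) _
      (Metric.isOpen_thickening.mem_nhdsSet.2 (Metric.self_subset_thickening hε (F (γ t))))
    obtain ⟨δ, hδ, hball⟩ := Metric.eventually_nhds_iff.1 hev
    refine Metric.isClosed_cthickening.mem_of_tendsto
      (hasDerivAt_iff_tendsto_slope_left_right.1 hder).2 ?_
    have hsmall : ∀ᶠ u in 𝓝[>] t, M * (u - t) + δ / 2 < δ := by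
      have hc : Continuous fun u : ℝ => M * (u - t) + δ / 2 := by fun_prop
      exact (hc.tendsto t).mono_left nhdsWithin_le_nhds |>.eventually_lt_const (by simpa using hδ)
    filter_upwards [hsmall, self_mem_nhdsWithin] with u hu htu
    rw [slope_def_module]
    refine hγ t u (δ / 2) _ hpos.le htu (half_pos hδ) ((hconv _).cthickening ε)
      Metric.isClosed_cthickening fun y hy => Metric.thickening_subset_cthickening _ _ ?_
    exact subset_of_mem_nhdsSet (hball (by rw [dist_eq_norm]; exact hy.trans_lt hu)) (hg y)
  rw [← (hcl (γ t)).closure_eq, Metric.closure_eq_iInter_cthickening]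
  exact mem_iInter₂.2 hmem

end Euler

variable {d : ℕ}

theorem OuterSemicontinuous.isClosed
    {F : EuclideanSpace ℝ (Fin d) → Set (EuclideanSpace ℝ (Fin d))}
    (hF : OuterSemicontinuous F) (x : EuclideanSpace ℝ (Fin d)) : IsClosed (F x) :=
  IsSeqClosed.isClosed fun vs v hvs hv => hF x v (fun _ => x) vs tendsto_const_nhds hv hvs

theorem GloballyBounded.isBounded
    {F : EuclideanSpace ℝ (Fin d) → Set (EuclideanSpace ℝ (Fin d))}
    (hF : GloballyBounded F) (x : EuclideanSpace ℝ (Fin d)) : Bornology.IsBounded (F x) :=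
  let ⟨M, hM⟩ := hF
  isBounded_iff_forall_norm_le.2 ⟨M, hM x⟩

theorem OuterSemicontinuous.upperHemicontinuous
    {F : EuclideanSpace ℝ (Fin d) → Set (EuclideanSpace ℝ (Fin d))}
    (hF : OuterSemicontinuous F) (hb : GloballyBounded F) : UpperHemicontinuous F := by
  obtain ⟨M, hM⟩ := hb
  refine upperHemicontinuous_iff.2 fun x => upperHemicontinuousAt_iff.2 fun U hU => ?_
  by_contra hcon
  obtain ⟨xs, hxs, hxU⟩ := exists_seq_forall_of_frequently (not_eventually.1 hcon)
  have : ∀ n, ∃ v ∈ F (xs n), v ∉ interior U := fun n => by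
    by_contra! h
    exact hxU n (mem_nhdsSet_iff_exists.2 ⟨interior U, isOpen_interior, h, interior_subset⟩)
  choose vs hvs hvU using this
  obtain ⟨v, -, φ, hφ, hv⟩ := (isCompact_closedBall (0 : EuclideanSpace ℝ (Fin d)) M).tendsto_subseq
    fun n => mem_closedBall_zero_iff.2 (hM _ _ (hvs n))
  have hvF : v ∈ F x := hF x v _ _ (hxs.comp hφ.tendsto_atTop) hv fun n => hvs (φ n)
  have hvI : v ∈ interior U := subset_interior_iff_mem_nhdsSet.2 hU hvF
  obtain ⟨n, hn⟩ := (hv.eventually (isOpen_interior.mem_nhds hvI)).exists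
  exact hvU _ hn

theorem regularity_and_solutions
    {F : EuclideanSpace ℝ (Fin d) → Set (EuclideanSpace ℝ (Fin d))}
    (hne : ∀ x, (F x).Nonempty) (hconv : ∀ x, Convex ℝ (F x)) (hF : OuterSemicontinuous F)
    (hb : GloballyBounded F) :
    (∀ x, (F x).Nonempty ∧ Convex ℝ (F x) ∧ IsCompact (F x)) ∧ OuterSemicontinuous F ∧
      GloballyBounded F ∧ IsMarchaud F ∧ ∀ x₀, ∃ γ, IsSolutionFrom F x₀ γ := by
  have hcpt : ∀ x, IsCompact (F x) := fun x =>
    Metric.isCompact_of_isClosed_isBounded (hF.isClosed x) (hb.isBounded x)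
  have huhc := hF.upperHemicontinuous hb
  obtain ⟨M, hM⟩ := id hb
  refine ⟨fun x => ⟨hne x, hconv x, hcpt x⟩, hF, hb, ⟨hne, hconv, hcpt, huhc, M, ?_⟩, ?_⟩
  · intro x v hv
    have hv := hM x v hv
    exact hv.trans (le_mul_of_one_le_right ((norm_nonneg v).trans hv) (by simp))
  · intro x₀
    obtain ⟨γ, h0, hlip, hder⟩ := exists_lipschitz_solution hne hconv hF.isClosed hM huhc x₀
    refine ⟨γ, h0, fun T hT => ?_, hder⟩
    refine (hlip.mono ?_).absolutelyContinuousOnInterval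
    rw [uIcc_of_le hT.le]
    exact Icc_subset_Ici_self

theorem mem_realSignSet_iff {a b : ℝ} : b ∈ realSignSet a ↔ |b| ≤ 1 ∧ b * a = |a| := by
  unfold realSignSet
  rcases lt_trichotomy a 0 with ha | rfl | ha
  · rw [if_neg ha.not_gt, if_pos ha, mem_singleton_iff, abs_of_neg ha]
    refine ⟨by rintro rfl; simp, fun h => mul_right_cancel₀ ha.ne (by linarith [h.2])⟩
  · simp [abs_le]
  · rw [if_pos ha, mem_singleton_iff, abs_of_pos ha]
    refine ⟨by rintro rfl; simp, fun h => mul_right_cancel₀ ha.ne' (by linarith [h.2])⟩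

theorem mem_signField_iff {f : EuclideanSpace ℝ (Fin d) → ℝ} {x v : EuclideanSpace ℝ (Fin d)} :
    v ∈ signField f x ↔ ∀ i, |v i| ≤ 1 ∧ -(v i * gradient f x i) = |gradient f x i| := by
  simp [signField, vecSignSet, mem_realSignSet_iff]

theorem nonempty_signField (f : EuclideanSpace ℝ (Fin d) → ℝ) (x : EuclideanSpace ℝ (Fin d)) :
    (signField f x).Nonempty := by
  refine ⟨WithLp.toLp 2 fun i => -Real.sign (gradient f x i), mem_signField_iff.2 fun i => ?_⟩
  rcases lt_trichotomy (gradient f x i) 0 with h | h | h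
  · simp [Real.sign_of_neg h, abs_of_neg h]
  · simp [h]
  · simp [Real.sign_of_pos h, abs_of_pos h]

theorem convex_signField (f : EuclideanSpace ℝ (Fin d) → ℝ) (x : EuclideanSpace ℝ (Fin d)) :
    Convex ℝ (signField f x) := by
  intro v hv w hw a b ha hb hab
  rw [mem_signField_iff] at *
  intro i
  obtain ⟨hv1, hv2⟩ := hv i
  obtain ⟨hw1, hw2⟩ := hw i
  simp only [PiLp.add_apply, PiLp.smul_apply, smul_eq_mul]
  refine ⟨?_, ?_⟩
  · rw [abs_le] at *
    constructor <;> nlinarith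
  · linear_combination a * hv2 + b * hw2 + |gradient f x i| * hab

theorem globallyBounded_signField (f : EuclideanSpace ℝ (Fin d) → ℝ) :
    GloballyBounded (signField f) := by
  refine ⟨√d, fun x v hv => ?_⟩
  rw [EuclideanSpace.norm_eq]
  refine Real.sqrt_le_sqrt ((Finset.sum_le_sum fun i _ =>
    pow_le_one₀ (n := 2) (norm_nonneg (v i)) (mem_signField_iff.1 hv i).1).trans ?_)
  simp

theorem continuous_gradient {f : EuclideanSpace ℝ (Fin d) → ℝ} (hf : ContDiff ℝ 1 f) :
    Continuous (gradient f) :=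
  (InnerProductSpace.toDual ℝ (EuclideanSpace ℝ (Fin d))).symm.continuous.comp
    (hf.continuous_fderiv one_ne_zero)

theorem outerSemicontinuous_signField {f : EuclideanSpace ℝ (Fin d) → ℝ} (hf : ContDiff ℝ 1 f) :
    OuterSemicontinuous (signField f) := by
  intro x v xs vs hxs hvs hmem
  rw [mem_signField_iff]
  intro i
  have hcoord : Continuous fun y : EuclideanSpace ℝ (Fin d) => y i := by fun_prop
  have hv : Tendsto (fun n => vs n i) atTop (𝓝 (v i)) := (hcoord.tendsto v).comp hvs
  have hg : Tendsto (fun n => gradient f (xs n) i) atTop (𝓝 (gradient f x i)) :=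
    ((hcoord.comp (continuous_gradient hf)).tendsto x).comp hxs
  refine ⟨le_of_tendsto hv.abs (Eventually.of_forall fun n => (mem_signField_iff.1 (hmem n) i).1),
    tendsto_nhds_unique (hv.mul hg).neg (hg.abs.congr fun n => ?_)⟩
  exact (mem_signField_iff.1 (hmem n) i).2.symm

variable {G : EuclideanSpace ℝ (Fin d) → Set (EuclideanSpace ℝ (Fin d))}

theorem subset_filippovMulti (x : EuclideanSpace ℝ (Fin d)) : G x ⊆ filippovMulti G x :=
  fun _ hv => mem_iInter₂.2 fun _ hδ =>
    subset_closure (subset_convexHull ℝ _ ⟨x, by simpa using hδ, hv⟩)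

theorem convex_filippovMulti (x : EuclideanSpace ℝ (Fin d)) : Convex ℝ (filippovMulti G x) :=
  convex_iInter₂ fun _ _ => (convex_convexHull ℝ _).closure

theorem GloballyBounded.filippovMulti (hG : GloballyBounded G) :
    GloballyBounded (filippovMulti G) := by
  obtain ⟨M, hM⟩ := hG
  refine ⟨M, fun x v hv => mem_closedBall_zero_iff.1 ?_⟩
  refine closure_minimal (convexHull_min ?_ (convex_closedBall _ _)) Metric.isClosed_closedBall
    (mem_iInter₂.1 hv 1 one_pos)
  rintro w ⟨y, -, hw⟩
  exact mem_closedBall_zero_iff.2 (hM y w hw)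

theorem outerSemicontinuous_filippovMulti : OuterSemicontinuous (filippovMulti G) := by
  intro x v xs vs hxs hvs hmem
  refine mem_iInter₂.2 fun δ hδ => isClosed_closure.mem_of_tendsto hvs ?_
  filter_upwards [Metric.tendsto_nhds.1 hxs (δ / 2) (half_pos hδ)] with n hn
  refine closure_mono (convexHull_mono ?_) (mem_iInter₂.1 (hmem n) (δ / 2) (half_pos hδ))
  rintro w ⟨y, hy, hw⟩
  rw [dist_eq_norm] at hn
  exact ⟨y, (norm_sub_le_norm_sub_add_norm_sub y (xs n) x).trans_lt (by linarith), hw⟩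

theorem nonempty_greedyDirections (hd : 0 < d) (f : EuclideanSpace ℝ (Fin d) → ℝ)
    (x : EuclideanSpace ℝ (Fin d)) : (greedyDirections f x).Nonempty := by
  have : Nonempty (Fin d) := ⟨⟨0, hd⟩⟩
  obtain ⟨i, hi⟩ := Finite.exists_max fun j => |gradient f x j|
  exact ⟨_, i, hi, rfl⟩

theorem norm_le_one_of_mem_greedyDirections {f : EuclideanSpace ℝ (Fin d) → ℝ}
    {x v : EuclideanSpace ℝ (Fin d)} (hv : v ∈ greedyDirections f x) : ‖v‖ ≤ 1 := by
  obtain ⟨i, -, rfl⟩ := hv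
  rw [norm_neg, norm_smul, PiLp.norm_single, norm_one, mul_one]
  rcases Real.sign_apply_eq (gradient f x i) with h | h | h <;> simp [h]

end SignFlow

theorem mainTheorem5 (d : ℕ) (hd : 0 < d) (f : EuclideanSpace ℝ (Fin d) → ℝ)
    (hf : ContDiff ℝ 1 f) :
    -- the sign field `-Sign (∇ f)`
    ((∀ x, (SignFlow.signField f x).Nonempty ∧ Convex ℝ (SignFlow.signField f x) ∧
          IsCompact (SignFlow.signField f x)) ∧
        SignFlow.OuterSemicontinuous (SignFlow.signField f) ∧
        SignFlow.GloballyBounded (SignFlow.signField f) ∧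
        SignFlow.IsMarchaud (SignFlow.signField f) ∧
        ∀ x₀, ∃ γ, SignFlow.IsSolutionFrom (SignFlow.signField f) x₀ γ) ∧
    -- the Filippov regularization of an arbitrary greedy coordinate selector
    (∀ G, SignFlow.IsGreedySelector f G →
      (∀ x, (SignFlow.filippov G x).Nonempty ∧ Convex ℝ (SignFlow.filippov G x) ∧
          IsCompact (SignFlow.filippov G x)) ∧
        SignFlow.OuterSemicontinuous (SignFlow.filippov G) ∧
        SignFlow.GloballyBounded (SignFlow.filippov G) ∧
        SignFlow.IsMarchaud (SignFlow.filippov G) ∧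
        ∀ x₀, ∃ γ, SignFlow.IsSolutionFrom (SignFlow.filippov G) x₀ γ) ∧
    -- the Filippov regularization of the multifunction of all greedy coordinate directions
    ((∀ x, (SignFlow.filippovMulti (SignFlow.greedyDirections f) x).Nonempty ∧
          Convex ℝ (SignFlow.filippovMulti (SignFlow.greedyDirections f) x) ∧
          IsCompact (SignFlow.filippovMulti (SignFlow.greedyDirections f) x)) ∧
        SignFlow.OuterSemicontinuous (SignFlow.filippovMulti (SignFlow.greedyDirections f)) ∧
        SignFlow.GloballyBounded (SignFlow.filippovMulti (SignFlow.greedyDirections f)) ∧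
        SignFlow.IsMarchaud (SignFlow.filippovMulti (SignFlow.greedyDirections f)) ∧
        ∀ x₀, ∃ γ, SignFlow.IsSolutionFrom
          (SignFlow.filippovMulti (SignFlow.greedyDirections f)) x₀ γ) := by
  open SignFlow in
  refine ⟨regularity_and_solutions (nonempty_signField f) (convex_signField f)
      (outerSemicontinuous_signField hf) (globallyBounded_signField f), fun G hG => ?_,
    regularity_and_solutions
      (fun x => (nonempty_greedyDirections hd f x).mono (subset_filippovMulti x))
      convex_filippovMulti outerSemicontinuous_filippovMulti
      (GloballyBounded.filippovMulti ⟨1, fun _ _ => norm_le_one_of_mem_greedyDirections⟩)⟩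
  exact regularity_and_solutions (F := filippovMulti fun x => {G x})
    (fun x => (Set.singleton_nonempty (G x)).mono (subset_filippovMulti x))
    convex_filippovMulti outerSemicontinuous_filippovMulti
    (GloballyBounded.filippovMulti
      ⟨1, fun x v hv => norm_le_one_of_mem_greedyDirections (f := f) (x := x) (hv ▸ hG x)⟩)
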